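/- Let $0<\epsilon\le 1$ and let $d$ be a natural number with $d\ge 10/\epsilon$. Write $\log$ for the logarithm to base $2$ and put $$ d_{A_2}=\Big\lceil \tfrac{112\ln 2}{\epsilon^2}\, d\log d\Big\rceil,\qquad n=\Big\lceil \tfrac{13440(\ln 2)^2}{\epsilon^5}\, d^3(\log d)^2\Big\rceil . $$ Let $\mathcal H_{A_2}$ and $\mathcal H_B$ be complex Hilbert spaces with $\dim\mathcal H_{A_2}=d_{A_2}$ and $\dim\mathcal H_B=d$. Then $d^2\le d_{A_2}d$, and for every natural number $m\le d_{A_2}d$ there exist $n$ isometries $U_1,\dots,U_n:\mathbb C^m\to\mathcal H_{A_2}\otimes\mathcal H_B$ such that, for every finite-dimensional Hilbert space $\mathcal H_{A_1}$ and every unit vector $|\psi\rangle\in\mathcal H_{A_1}\otimes\mathbb C^m$, $$ \frac1n\,\#\Big\{k\in\{1,\dots,n\} : \big\|\mathrm{Tr}_{A_1A_2}\,(I_{A_1}\otimes U_k)\,|\psi\rangle\langle\psi|\,(I_{A_1}\otimes U_k)^\dagger\big\|_\infty<\frac{1+\epsilon}{d}\Big\}\ \ge\ 1-\epsilon , $$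 where $\|\cdot\|_\infty$ is the operator norm. In particular this holds for $m=d^2$ (isometries that take $d^2$-dimensional states into $\mathcal H_{A_2}\otimes\mathcal H_B$) and for $m=d_{A_2}d$ (unitaries of $\mathcal H_{A_2}\otimes\mathcal H_B$ and arbitrary pure states of $A_1A_2B$). -/

import Mathlib

open scoped Kronecker

namespace SuperdenseCoding

/-- The density matrix `|ψ⟩⟨ψ|` of a vector `ψ` of `ℂ^ι`. -/
noncomputable def ketBra {ι : Type*} (ψ : EuclideanSpace ℂ ι) : Matrix ι ι ℂ :=
  Matrix.vecMulVec (fun i => ψ i) (fun i => star (ψ i))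

/-- The partial trace over the first factor of `ℂ^α ⊗ ℂ^β = ℂ^(α × β)`. -/
def traceLeft {α β : Type*} [Fintype α] (M : Matrix (α × β) (α × β) ℂ) : Matrix β β ℂ :=
  Matrix.of fun b b' => ∑ a, M (a, b) (a, b')

/-- The operator norm `‖M‖_∞` of a matrix acting on the Hilbert space `ℂ^β`. -/
noncomputable def opNorm {β : Type*} [Fintype β] [DecidableEq β] (M : Matrix β β ℂ) : ℝ :=
  ‖Matrix.toEuclideanCLM (n := β) (𝕜 := ℂ) M‖

/-- The matrix `U` represents an isometry `ℂ^ι → ℂ^κ`, i.e. `U† U = I`. -/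
def IsIsometry {κ ι : Type*} [Fintype κ] [DecidableEq ι] (U : Matrix κ ι ℂ) : Prop :=
  U.conjTranspose * U = 1

/-- The state `Tr_{A₁A₂} (I_{A₁} ⊗ U) |ψ⟩⟨ψ| (I_{A₁} ⊗ U)†` of `B`, where `α₁`, `α₂`, `β` index
orthonormal bases of `A₁`, `A₂`, `B`, and `ι` one of the space on which `U` is defined. -/
noncomputable def reducedState {α₁ α₂ β ι : Type*} [Fintype α₁] [DecidableEq α₁] [Fintype α₂]
    [Fintype ι] (U : Matrix (α₂ × β) ι ℂ) (ψ : EuclideanSpace ℂ (α₁ × ι)) : Matrix β β ℂ :=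
  let V : Matrix (α₁ × α₂ × β) (α₁ × ι) ℂ := (1 : Matrix α₁ α₁ ℂ) ⊗ₖ U
  traceLeft (traceLeft (V * ketBra ψ * V.conjTranspose))

/-- The dimension `(112 ln 2 / ε²) d log₂ d` of `A₂`, rounded up to an integer. -/
noncomputable def dimA₂ (ε : ℝ) (d : ℕ) : ℕ :=
  ⌈112 * Real.log 2 / ε ^ 2 * (d * Real.logb 2 d)⌉₊

/-- The number `(13440 (ln 2)² / ε⁵) d³ (log₂ d)²` of isometries, rounded up to an integer. -/
noncomputable def numIsometries (ε : ℝ) (d : ℕ) : ℕ :=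
  ⌈13440 * Real.log 2 ^ 2 / ε ^ 5 * ((d : ℝ) ^ 3 * Real.logb 2 d ^ 2)⌉₊

end SuperdenseCoding

/-! Independent Haar-random unitaries work with positive probability. Read a vector of `A₂ ⊗ B` as
an operator from `A₂` to `B` (`slice`); the largest eigenvalue of its reduced state on `B` is the
squared norm of that operator. Everything rests on the excess of this eigenvalue over `c = (1 +
ε/2)/d`.

With `a = dim A₂`, the `t`-th moment of the eigenvalue at a Haar-random unit vector is at most a
ratio of rising factorials, `a⁽ᵗ⁾ d⁽ᵗ⁾ / (t! (ad)⁽ᵗ⁾)` (`lintegral_norm_slice_pow_le`): the norm is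
tested against a Gaussian vector, and Gaussian and Haar averages of homogeneous functions differ
only by a radial moment. Taking `t` of order `ε a` makes the mean excess at most `1/d³`
(`moment_bound_le`, `lintegral_excess_le`).

An exponential-moment bound with a union bound over a net of the unit sphere of `A₂ ⊗ B`, and a
Lipschitz estimate off the net, give unitaries whose total excess is at most `n ε²/(2d)` at every
unit vector simultaneously (`exists_unitaries_sum_excess_le`).

The ancilla needs no net of its own, so its dimension is unrestricted: the reduced state of `ψ` is a
mixture of reduced states of vectors of `A₂ ⊗ B`, and the bound on total excess survives averaging
over the mixture. Markov's inequality over `k` then leaves at most `ε n` bad indices, a bad one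
costing at least the gap `ε/(2d)` between `(1 + ε)/d` and `c` (`card_filter_le_of_sum_excess_le`).
-/

namespace SuperdenseCoding

open MeasureTheory Module ENNReal Matrix

/-! ### Standard Gaussian measures and their radial moments -/

section Gaussian

variable (V : Type*) [NormedAddCommGroup V] [InnerProductSpace ℝ V] [FiniteDimensional ℝ V]
  [MeasurableSpace V] [BorelSpace V]

/-- The Gaussian measure with density proportional to `exp (-‖x‖²)`. -/
noncomputable def gaussian : Measure V :=
  volume.withDensity fun x =>
    ENNReal.ofReal (Real.exp (-‖x‖ ^ 2) / ∫ y : V, Real.exp (-‖y‖ ^ 2))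

theorem integral_exp_neg_sq_norm_pos : 0 < ∫ y : V, Real.exp (-‖y‖ ^ 2) := by
  have h := GaussianFourier.integral_rexp_neg_mul_sq_norm (V := V) one_pos
  simp only [neg_mul, one_mul, div_one] at h
  rw [h]
  positivity

theorem measurable_gaussian_density : Measurable fun x : V =>
    ENNReal.ofReal (Real.exp (-‖x‖ ^ 2) / ∫ y : V, Real.exp (-‖y‖ ^ 2)) := by
  fun_prop

instance : IsProbabilityMeasure (gaussian V) where
  measure_univ := by
    have h := integral_exp_neg_sq_norm_pos V
    have hi : Integrable fun y : V => Real.exp (-‖y‖ ^ 2) := .of_integral_ne_zero h.ne'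
    rw [gaussian, withDensity_apply _ MeasurableSet.univ, Measure.restrict_univ,
      ← ofReal_integral_eq_lintegral_ofReal (hi.div_const _)
        (.of_forall fun x => by positivity), integral_div, div_self h.ne', ENNReal.ofReal_one]

theorem charFun_gaussian (t : V) :
    charFun (gaussian V) t = Complex.exp (-(‖t‖ ^ 2 / 4 : ℝ)) := by
  have h := integral_exp_neg_sq_norm_pos V
  have h1 := GaussianFourier.integral_cexp_neg_mul_sq_norm_add (V := V) (b := 1) (by simp)
    Complex.I t
  have h2 := GaussianFourier.integral_cexp_neg_mul_sq_norm (V := V) (b := 1) (by simp)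
  rw [← h2] at h1
  have h3 : ∫ v : V, Complex.exp (-1 * ‖v‖ ^ 2) = ((∫ y : V, Real.exp (-‖y‖ ^ 2) : ℝ) : ℂ) := by
    rw [← integral_complex_ofReal]
    simp
  rw [h3] at h1
  rw [charFun_apply, gaussian, integral_withDensity_eq_integral_toReal_smul
    (measurable_gaussian_density V) (.of_forall fun _ => ENNReal.ofReal_lt_top)]
  have h4 : ∀ x : V, (ENNReal.ofReal
      (Real.exp (-‖x‖ ^ 2) / ∫ y : V, Real.exp (-‖y‖ ^ 2))).toReal •
        Complex.exp (inner ℝ x t * Complex.I) =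
      Complex.exp (-1 * ‖x‖ ^ 2 + Complex.I * inner ℝ t x) /
        ((∫ y : V, Real.exp (-‖y‖ ^ 2) : ℝ) : ℂ) := by
    intro x
    rw [ENNReal.toReal_ofReal (by positivity), Complex.real_smul, Complex.exp_add,
      real_inner_comm, mul_comm Complex.I]
    push_cast
    rw [neg_one_mul]
    ring
  simp_rw [h4]
  rw [integral_div, h1, mul_div_cancel_left₀ _ (by exact_mod_cast h.ne')]
  congr 1
  push_cast
  rw [Complex.I_sq]
  ring

variable {V}

/-- The characteristic function depends only on the norm, and pushing forward by `L` replaces `t` by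
`L.adjoint t`. So `L` need only be a co-isometry, which covers unitaries and contractions alike. -/
theorem map_gaussian {W : Type*} [NormedAddCommGroup W] [InnerProductSpace ℝ W]
    [FiniteDimensional ℝ W] [MeasurableSpace W] [BorelSpace W] (L : V →L[ℝ] W)
    (hL : ∀ w, ‖L.adjoint w‖ = ‖w‖) : (gaussian V).map L = gaussian W := by
  have := Measure.isProbabilityMeasure_map (μ := gaussian V) (f := L) (by fun_prop)
  apply Measure.ext_of_charFun
  ext t
  rw [charFun_gaussian, charFun_apply, integral_map (by fun_prop) (by fun_prop), ← hL,
    ← charFun_gaussian, charFun_apply]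
  simp_rw [ContinuousLinearMap.adjoint_inner_right]

theorem integral_norm_pow_mul_exp {N : ℕ} (hN : 0 < N) (hV : finrank ℝ V = 2 * N) (t : ℕ) :
    ∫ x : V, ‖x‖ ^ (2 * t) * Real.exp (-‖x‖ ^ 2) =
      (2 * N) * (volume.real (Metric.ball (0 : V) 1)) * (1 / 2 * Real.Gamma (N + t)) := by
  have : Nontrivial V := Module.nontrivial_of_finrank_pos (R := ℝ) (by omega)
  have h := integral_fun_norm_addHaar (volume : Measure V)
    (fun y => y ^ (2 * t) * Real.exp (-y ^ 2))
  rw [h, hV, nsmul_eq_mul, smul_eq_mul, mul_assoc]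
  push_cast
  congr 2
  have h2 := integral_rpow_mul_exp_neg_rpow (p := 2) (q := 2 * N - 1 + 2 * t) (by norm_num)
    (by have : (1 : ℝ) ≤ N := by exact_mod_cast hN
        have : (0 : ℝ) ≤ t := by positivity
        linarith)
  rw [show (2 * (N : ℝ) - 1 + 2 * t + 1) / 2 = N + t by ring] at h2
  rw [← h2]
  refine setIntegral_congr_fun measurableSet_Ioi fun y hy => ?_
  simp only [smul_eq_mul]
  rw [← mul_assoc, ← pow_add, ← Real.rpow_natCast, Real.rpow_two]
  congr 2
  rw [Nat.cast_add, Nat.cast_sub (by omega)]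
  push_cast
  ring

/-- In polar coordinates the ratio to the total mass is `Γ(N + t)/Γ(N)`, where `N` is the complex
dimension. -/
theorem lintegral_norm_pow_gaussian {N : ℕ} (hN : 0 < N) (hV : finrank ℝ V = 2 * N) (t : ℕ) :
    ∫⁻ x, ENNReal.ofReal (‖x‖ ^ (2 * t)) ∂gaussian V = (N.ascFactorial t : ℕ) := by
  have h := integral_exp_neg_sq_norm_pos V
  have h0 := integral_norm_pow_mul_exp hN hV 0
  have ht := integral_norm_pow_mul_exp hN hV t
  simp only [mul_zero, pow_zero, one_mul, Nat.cast_zero, add_zero] at h0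
  have hG : Real.Gamma (N + t) = N.ascFactorial t * Real.Gamma N := by
    obtain ⟨k, rfl⟩ : ∃ k, N = k + 1 := ⟨N - 1, by omega⟩
    rw [show ((k + 1 : ℕ) : ℝ) + t = ((k + t : ℕ) : ℝ) + 1 by push_cast; ring,
      Real.Gamma_nat_eq_factorial, Nat.cast_add, Nat.cast_one, Real.Gamma_nat_eq_factorial,
      ← Nat.factorial_mul_ascFactorial]
    push_cast
    ring
  have ht' : ∫ x : V, ‖x‖ ^ (2 * t) * Real.exp (-‖x‖ ^ 2) =
      N.ascFactorial t * ∫ x : V, Real.exp (-‖x‖ ^ 2) := by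
    rw [ht, hG, h0]; ring
  have hA : (0 : ℝ) < N.ascFactorial t := by
    obtain ⟨k, rfl⟩ : ∃ k, N = k + 1 := ⟨N - 1, by omega⟩
    exact_mod_cast Nat.ascFactorial_pos k t
  have hi : Integrable fun x : V => ‖x‖ ^ (2 * t) * Real.exp (-‖x‖ ^ 2) :=
    .of_integral_ne_zero (by rw [ht']; positivity)
  rw [gaussian, lintegral_withDensity_eq_lintegral_mul _ (measurable_gaussian_density V)
    (by fun_prop)]
  simp only [Pi.mul_apply]
  have h4 : ∀ x : V, ENNReal.ofReal (Real.exp (-‖x‖ ^ 2) / ∫ y : V, Real.exp (-‖y‖ ^ 2)) *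
        ENNReal.ofReal (‖x‖ ^ (2 * t)) =
      ENNReal.ofReal (‖x‖ ^ (2 * t) * Real.exp (-‖x‖ ^ 2) /
        ∫ y : V, Real.exp (-‖y‖ ^ 2)) := by
    intro x
    rw [← ENNReal.ofReal_mul (by positivity)]
    congr 1
    ring
  simp_rw [h4]
  rw [← ofReal_integral_eq_lintegral_ofReal (hi.div_const _) (.of_forall fun x => by positivity),
    integral_div, ht', mul_div_cancel_right₀ _ h.ne', ENNReal.ofReal_natCast]

end Gaussian

/-! ### Haar measure on the unitary group; from Gaussian to Haar averages -/

section Haar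

variable {ι : Type*} [Fintype ι] [DecidableEq ι]

instance : SecondCountableTopology (unitaryGroup ι ℂ) :=
  have : SecondCountableTopology (Matrix ι ι ℂ) :=
    inferInstanceAs (SecondCountableTopology (ι → ι → ℂ))
  TopologicalSpace.Subtype.secondCountableTopology _

instance : CompactSpace (unitaryGroup ι ℂ) := by
  refine isCompact_iff_compactSpace.mp (?_ : IsCompact (unitaryGroup ι ℂ : Set (Matrix ι ι ℂ)))
  have hK : IsCompact (Set.univ.pi fun _ : ι => Set.univ.pi fun _ : ι =>
      Metric.closedBall (0 : ℂ) 1) :=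
    isCompact_univ_pi fun _ => isCompact_univ_pi fun _ => isCompact_closedBall _ _
  refine IsCompact.of_isClosed_subset (X := Matrix ι ι ℂ) hK isClosed_unitary fun U hU => ?_
  exact fun i _ j _ => mem_closedBall_zero_iff.mpr (entry_norm_bound_of_unitary hU i j)

noncomputable instance : MeasurableSpace (unitaryGroup ι ℂ) := borel _

instance : BorelSpace (unitaryGroup ι ℂ) := ⟨rfl⟩

variable (ι) in
/-- The Haar probability measure of the unitary group. -/
noncomputable def unitaryHaar : Measure (unitaryGroup ι ℂ) :=
  Measure.haarMeasure ⊤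

instance : IsProbabilityMeasure (unitaryHaar ι) where
  measure_univ := Measure.haarMeasure_self (K₀ := ⊤)

instance : (unitaryHaar ι).IsMulLeftInvariant := by
  unfold unitaryHaar; infer_instance

/-- The action of a unitary matrix on `ℂ^ι`. -/
noncomputable def act (U : unitaryGroup ι ℂ) : EuclideanSpace ℂ ι →L[ℂ] EuclideanSpace ℂ ι :=
  toEuclideanCLM (n := ι) (𝕜 := ℂ) (U : Matrix ι ι ℂ)

theorem act_mem_unitary (U : unitaryGroup ι ℂ) :
    act U ∈ unitary (EuclideanSpace ℂ ι →L[ℂ] EuclideanSpace ℂ ι) :=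
  Unitary.map_mem (toEuclideanCLM (n := ι) (𝕜 := ℂ)) U.2

theorem norm_act (U : unitaryGroup ι ℂ) (x : EuclideanSpace ℂ ι) : ‖act U x‖ = ‖x‖ :=
  ContinuousLinearMap.norm_map_of_mem_unitary (act_mem_unitary U) x

theorem act_mul (U V : unitaryGroup ι ℂ) (x : EuclideanSpace ℂ ι) :
    act (U * V) x = act U (act V x) := by
  simp [act]

theorem continuous_act :
    Continuous fun p : unitaryGroup ι ℂ × EuclideanSpace ℂ ι => act p.1 p.2 := by
  have : (fun p : unitaryGroup ι ℂ × EuclideanSpace ℂ ι => act p.1 p.2) =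
      fun p => WithLp.toLp 2 ((p.1 : Matrix ι ι ℂ) *ᵥ p.2.ofLp) := by
    ext p i
    simp [act]
  rw [this]
  refine (PiLp.continuous_toLp 2 _).comp (Continuous.matrix_mulVec ?_ ?_)
  · exact continuous_subtype_val.comp continuous_fst
  · exact (PiLp.continuous_ofLp 2 _).comp continuous_snd

theorem continuous_act_inv (x : EuclideanSpace ℂ ι) :
    Continuous fun U : unitaryGroup ι ℂ => act U⁻¹ x :=
  Continuous.comp (g := fun p : unitaryGroup ι ℂ × EuclideanSpace ℂ ι => act p.1 p.2)
    (f := fun U => (U⁻¹, x)) continuous_act (continuous_inv.prodMk continuous_const)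

theorem exists_act_eq {x y : EuclideanSpace ℂ ι} (hx : ‖x‖ = 1) (hy : ‖y‖ = 1) :
    ∃ U : unitaryGroup ι ℂ, act U x = y := by
  have : Nonempty ι := by
    by_contra h
    rw [not_nonempty_iff] at h
    rw [Subsingleton.elim x 0, norm_zero] at hx
    exact zero_ne_one hx
  obtain ⟨i₀⟩ := this
  have key : ∀ z : EuclideanSpace ℂ ι, ‖z‖ = 1 →
      ∃ b : OrthonormalBasis ι ℂ (EuclideanSpace ℂ ι), b i₀ = z := by
    intro z hz
    have ho : Orthonormal ℂ (({i₀} : Set ι).domRestrict fun _ => z) := by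
      refine ⟨fun _ => hz, fun i j hij => (hij (Subsingleton.elim i j)).elim⟩
    obtain ⟨b, hb⟩ := ho.exists_orthonormalBasis_extension_of_card_eq (by simp)
    exact ⟨b, hb i₀ rfl⟩
  obtain ⟨b, rfl⟩ := key x hx
  obtain ⟨c, rfl⟩ := key y hy
  let W := Unitary.linearIsometryEquiv.symm (b.repr.trans c.repr.symm)
  refine ⟨⟨(toEuclideanCLM (n := ι) (𝕜 := ℂ)).symm W,
    Unitary.map_mem (toEuclideanCLM (n := ι) (𝕜 := ℂ)).symm W.2⟩, ?_⟩
  simp only [act, StarAlgEquiv.apply_symm_apply]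
  simp [W]

theorem map_act_gaussian (U : unitaryGroup ι ℂ) :
    (gaussian (EuclideanSpace ℂ ι)).map (act U) = gaussian (EuclideanSpace ℂ ι) := by
  have hsurj : ∀ y, act U (act U⁻¹ y) = y := fun y => by
    rw [← act_mul, mul_inv_cancel]; simp [act]
  let e : EuclideanSpace ℂ ι ≃ₗᵢ[ℝ] EuclideanSpace ℂ ι :=
    LinearIsometryEquiv.ofSurjective
      ⟨((act U).restrictScalars ℝ).toLinearMap, norm_act U⟩ fun y => ⟨act U⁻¹ y, hsurj y⟩
  have h := map_gaussian (e : EuclideanSpace ℂ ι →L[ℝ] EuclideanSpace ℂ ι) (fun w => by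
    rw [LinearIsometryEquiv.adjoint_eq_symm]
    exact e.symm.norm_map w)
  exact h

/-- Unitaries act transitively on the sphere, so the Haar average of a homogeneous function at `x`
is its value at `ψ` scaled by a power of `‖x‖`. Integrating over a Gaussian `x` and swapping the
integrals gives the identity, since the Gaussian is unitarily invariant. -/
theorem lintegral_unitaryHaar_mul {h : EuclideanSpace ℂ ι → ℝ≥0∞} (hm : Measurable h) (t : ℕ)
    (hh : ∀ c : ℝ, 0 ≤ c → ∀ x, h ((c : ℂ) • x) = ENNReal.ofReal (c ^ (2 * t)) * h x)
    {ψ : EuclideanSpace ℂ ι} (hψ : ‖ψ‖ = 1) :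
    (∫⁻ U, h (act U⁻¹ ψ) ∂unitaryHaar ι) *
        ∫⁻ x, ENNReal.ofReal (‖x‖ ^ (2 * t)) ∂gaussian (EuclideanSpace ℂ ι) =
      ∫⁻ x, h x ∂gaussian (EuclideanSpace ℂ ι) := by
  have hc : Measurable fun p : unitaryGroup ι ℂ × EuclideanSpace ℂ ι => h (act p.1⁻¹ p.2) :=
    hm.comp (continuous_act.comp (continuous_fst.inv.prodMk continuous_snd)).measurable
  have hΦ : ∀ x, ∫⁻ U, h (act U⁻¹ x) ∂unitaryHaar ι =
      (∫⁻ U, h (act U⁻¹ ψ) ∂unitaryHaar ι) * ENNReal.ofReal (‖x‖ ^ (2 * t)) := by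
    intro x
    obtain ⟨V, hV⟩ : ∃ V : unitaryGroup ι ℂ, x = ((‖x‖ : ℝ) : ℂ) • act V ψ := by
      by_cases hx : x = 0
      · exact ⟨1, by simp [hx]⟩
      · obtain ⟨V, hV⟩ := exists_act_eq hψ
          (y := ((‖x‖⁻¹ : ℝ) : ℂ) • x) (by simp [norm_smul, hx])
        refine ⟨V, ?_⟩
        rw [hV, smul_smul]
        simp [hx]
    -- Acting by `U⁻¹` turns a change of vector into left translation of `U`, so left invariance of
    -- Haar measure suffices.
    have h1 : ∀ U : unitaryGroup ι ℂ, h (act U⁻¹ x) =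
        ENNReal.ofReal (‖x‖ ^ (2 * t)) * h (act (V⁻¹ * U)⁻¹ ψ) := by
      intro U
      rw [_root_.mul_inv_rev, inv_inv, act_mul, ← hh _ (norm_nonneg x), ← map_smul, ← hV]
    simp_rw [h1]
    rw [lintegral_const_mul _ (by
      exact (hc.comp (measurable_id.prodMk measurable_const)).comp (measurable_const_mul V⁻¹)),
      lintegral_mul_left_eq_self (fun U => h (act U⁻¹ ψ)), mul_comm]
  rw [← lintegral_const_mul _ (by fun_prop)]
  simp_rw [← hΦ]
  rw [lintegral_lintegral_swap (f := fun x (U : unitaryGroup ι ℂ) => h (act U⁻¹ x))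
    (hc.comp measurable_swap).aemeasurable]
  have h2 : ∀ U : unitaryGroup ι ℂ, ∫⁻ x, h (act U⁻¹ x) ∂gaussian (EuclideanSpace ℂ ι) =
      ∫⁻ x, h x ∂gaussian (EuclideanSpace ℂ ι) := by
    intro U
    conv_rhs => rw [← map_act_gaussian U⁻¹]
    rw [lintegral_map hm (act U⁻¹).continuous.measurable]
  simp_rw [h2]
  simp

end Haar

/-! ### Moments of linear images of a complex Gaussian vector -/

section Moments

variable {ι κ : Type*} [Fintype ι] [Fintype κ]

theorem finrank_real_euclideanSpace_complex :
    finrank ℝ (EuclideanSpace ℂ ι) = 2 * Fintype.card ι := by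
  have h := finrank_real_of_complex (EuclideanSpace ℂ ι)
  rw [finrank_euclideanSpace] at h
  exact h

theorem real_inner_euclideanSpace_complex (x y : EuclideanSpace ℂ ι) :
    inner ℝ x y = (inner ℂ x y).re := by
  simp [PiLp.inner_apply, Complex.inner]

theorem lintegral_norm_pow_gaussian_euclideanSpace (ι : Type*) [Fintype ι] [Nonempty ι] (t : ℕ) :
    ∫⁻ x, ENNReal.ofReal (‖x‖ ^ (2 * t)) ∂gaussian (EuclideanSpace ℂ ι) =
      ((Fintype.card ι).ascFactorial t : ℕ) :=
  lintegral_norm_pow_gaussian Fintype.card_pos finrank_real_euclideanSpace_complex t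

/-- `R` plays the adjoint of `L`. For `c > 0` the map `c⁻¹ L` is a co-isometry, so `L x` is
distributed as `c` times a Gaussian vector; for `c = 0` the map `L` vanishes. -/
theorem lintegral_norm_pow_map_gaussian [Nonempty κ]
    (L : EuclideanSpace ℂ ι →ₗ[ℂ] EuclideanSpace ℂ κ)
    (R : EuclideanSpace ℂ κ → EuclideanSpace ℂ ι) {c : ℝ} (hc : 0 ≤ c)
    (hR : ∀ y, ‖R y‖ = c * ‖y‖) (hLR : ∀ y x, inner ℂ (R y) x = inner ℂ y (L x)) (t : ℕ) :
    ∫⁻ x, ENNReal.ofReal (‖L x‖ ^ (2 * t)) ∂gaussian (EuclideanSpace ℂ ι) =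
      ENNReal.ofReal (c ^ (2 * t)) * ((Fintype.card κ).ascFactorial t : ℕ) := by
  rcases hc.eq_or_lt with rfl | hc
  · have hL : ∀ x, L x = 0 := fun x => by
      have hR0 : R (L x) = 0 := by rw [← norm_eq_zero, hR, zero_mul]
      rw [← inner_self_eq_zero (𝕜 := ℂ), ← hLR, hR0, inner_zero_left]
    rcases Nat.eq_zero_or_pos t with rfl | ht
    · simp
    · simp [hL, ht.ne']
  · let M : EuclideanSpace ℂ ι →L[ℝ] EuclideanSpace ℂ κ :=
      ((((c⁻¹ : ℝ) : ℂ) • L).restrictScalars ℝ).toContinuousLinearMap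
    have hM : ∀ x, M x = ((c⁻¹ : ℝ) : ℂ) • L x := fun x => rfl
    have hadj : ∀ y, M.adjoint y = ((c⁻¹ : ℝ) : ℂ) • R y := by
      intro y
      refine ext_inner_right ℝ fun x => ?_
      rw [ContinuousLinearMap.adjoint_inner_left, hM, real_inner_euclideanSpace_complex,
        real_inner_euclideanSpace_complex, inner_smul_left, inner_smul_right, hLR,
        Complex.conj_ofReal]
    have hmap := map_gaussian M fun y => by
      rw [hadj, norm_smul, hR, Complex.norm_real, norm_inv, Real.norm_of_nonneg hc.le]
      field_simp
    have h1 : ∀ x, ENNReal.ofReal (‖L x‖ ^ (2 * t)) =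
        ENNReal.ofReal (c ^ (2 * t)) * ENNReal.ofReal (‖M x‖ ^ (2 * t)) := by
      intro x
      rw [← ENNReal.ofReal_mul (by positivity), ← mul_pow, hM, norm_smul, Complex.norm_real,
        norm_inv, Real.norm_of_nonneg hc.le, mul_inv_cancel_left₀ hc.ne']
    simp_rw [h1]
    rw [lintegral_const_mul _ (by fun_prop), ← lintegral_norm_pow_gaussian_euclideanSpace κ, ← hmap,
      lintegral_map (by fun_prop) (by fun_prop)]

theorem lintegral_norm_inner_pow_gaussian (u : EuclideanSpace ℂ ι) (t : ℕ) :
    ∫⁻ x, ENNReal.ofReal (‖inner ℂ u x‖ ^ (2 * t)) ∂gaussian (EuclideanSpace ℂ ι) =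
      ENNReal.ofReal (‖u‖ ^ (2 * t)) * (t.factorial : ℕ) := by
  have h := lintegral_norm_pow_map_gaussian (κ := Unit)
    (L := { toFun := fun x => WithLp.toLp 2 fun _ => inner ℂ u x
            map_add' := fun x y => by ext; simp
            map_smul' := fun c x => by ext; simp })
    (R := fun y => y () • u) (norm_nonneg u)
    (fun y => by simp [norm_smul, EuclideanSpace.norm_eq, mul_comm])
    (fun y x => by simp [PiLp.inner_apply, mul_comm]) t
  rw [Fintype.card_unit, Nat.one_ascFactorial] at h
  rw [← h]
  simp [EuclideanSpace.norm_eq]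

end Moments

/-! ### Bipartite vectors as operators, and moments of their norms -/

section Slices

variable {α β : Type*} [Fintype β]

/-- The contraction `ℂ^(α × β) → ℂ^α` of the second factor with the vector `b`. -/
noncomputable def contract (b : EuclideanSpace ℂ β) :
    EuclideanSpace ℂ (α × β) →ₗ[ℂ] EuclideanSpace ℂ α where
  toFun x := WithLp.toLp 2 fun a => ∑ j, star (b j) * x (a, j)
  map_add' x y := by ext; simp [mul_add, Finset.sum_add_distrib]
  map_smul' c x := by ext; simp [Finset.mul_sum, mul_left_comm]

theorem contract_apply (b : EuclideanSpace ℂ β) (x : EuclideanSpace ℂ (α × β)) (a : α) :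
    contract b x a = ∑ j, star (b j) * x (a, j) := rfl

theorem continuous_contract : Continuous fun p : EuclideanSpace ℂ (α × β) × EuclideanSpace ℂ β =>
    contract p.2 p.1 := by
  refine (PiLp.continuous_toLp 2 _).comp (continuous_pi fun a => ?_)
  fun_prop

variable [Fintype α]

/-- The linear map `ℂ^α → ℂ^β` with coefficients `x (a, b)`, depending linearly on `x`. -/
noncomputable def slice :
    EuclideanSpace ℂ (α × β) →ₗ[ℂ] EuclideanSpace ℂ α →L[ℂ] EuclideanSpace ℂ β where
  toFun x := LinearMap.toContinuousLinearMap
    { toFun := fun y => WithLp.toLp 2 fun b => ∑ a, x (a, b) * y a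
      map_add' := fun y z => by ext; simp [mul_add, Finset.sum_add_distrib]
      map_smul' := fun c y => by ext; simp [Finset.mul_sum, mul_left_comm] }
  map_add' x y := by ext; simp [add_mul, Finset.sum_add_distrib]
  map_smul' c x := by ext; simp [Finset.mul_sum, mul_assoc]

theorem slice_apply (x : EuclideanSpace ℂ (α × β)) (y : EuclideanSpace ℂ α) (b : β) :
    slice x y b = ∑ a, x (a, b) * y a := rfl

theorem norm_toLp_mul (b : EuclideanSpace ℂ β) (y : EuclideanSpace ℂ α) :
    ‖(WithLp.toLp 2 fun p : α × β => y p.1 * b p.2 : EuclideanSpace ℂ (α × β))‖ =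
      ‖b‖ * ‖y‖ := by
  rw [EuclideanSpace.norm_eq, EuclideanSpace.norm_eq, EuclideanSpace.norm_eq,
    ← Real.sqrt_mul (by positivity), mul_comm, Finset.sum_mul_sum, Fintype.sum_prod_type]
  simp [mul_pow]

theorem inner_toLp_mul (b : EuclideanSpace ℂ β) (y : EuclideanSpace ℂ α)
    (x : EuclideanSpace ℂ (α × β)) :
    inner ℂ (WithLp.toLp 2 fun p : α × β => y p.1 * b p.2 : EuclideanSpace ℂ (α × β)) x =
      inner ℂ y (contract b x) := by
  simp only [PiLp.inner_apply, contract_apply, Fintype.sum_prod_type, RCLike.inner_apply, map_mul,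
    Finset.sum_mul]
  refine Finset.sum_congr rfl fun a _ => Finset.sum_congr rfl fun j _ => ?_
  rw [starRingEnd_apply, starRingEnd_apply]
  ring

theorem norm_contract_le (b : EuclideanSpace ℂ β) (x : EuclideanSpace ℂ (α × β)) :
    ‖contract b x‖ ≤ ‖b‖ * ‖x‖ := by
  by_cases h : contract b x = 0
  · rw [h, norm_zero]; positivity
  have h1 : ‖contract b x‖ * ‖contract b x‖ ≤ ‖b‖ * ‖x‖ * ‖contract b x‖ := by
    have h2 := norm_inner_le_norm (𝕜 := ℂ) (WithLp.toLp 2 fun p : α × β =>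
      contract b x p.1 * b p.2 : EuclideanSpace ℂ (α × β)) x
    rw [inner_toLp_mul, norm_toLp_mul, inner_self_eq_norm_sq_to_K, norm_pow, RCLike.norm_ofReal, abs_norm] at h2
    nlinarith
  exact le_of_mul_le_mul_right h1 (norm_pos_iff.mpr h)

/-- Both sides contract the same tensor: pairing `slice x y` with `b` is, up to conjugation, pairing
`contract b x` with the conjugate of `y`. Cauchy–Schwarz does the rest. -/
theorem norm_inner_slice_le (b : EuclideanSpace ℂ β) (x : EuclideanSpace ℂ (α × β))
    (y : EuclideanSpace ℂ α) : ‖inner ℂ (slice x y) b‖ ≤ ‖y‖ * ‖contract b x‖ := by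
  have h : inner ℂ b (slice x y) =
      inner ℂ (WithLp.toLp 2 fun a => star (y a) : EuclideanSpace ℂ α) (contract b x) := by
    simp only [PiLp.inner_apply, contract_apply, slice_apply, RCLike.inner_apply, Finset.sum_mul]
    rw [Finset.sum_comm]
    refine Finset.sum_congr rfl fun a _ => Finset.sum_congr rfl fun j _ => ?_
    simp only [starRingEnd_apply, star_star]
    ring
  rw [norm_inner_symm, h]
  refine (norm_inner_le_norm _ _).trans_eq ?_
  simp [EuclideanSpace.norm_eq]

theorem norm_slice_le (x : EuclideanSpace ℂ (α × β)) : ‖slice x‖ ≤ ‖x‖ := by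
  refine ContinuousLinearMap.opNorm_le_bound _ (norm_nonneg _) fun y => ?_
  by_cases h : slice x y = 0
  · rw [h, norm_zero]; positivity
  have h1 : ‖slice x y‖ * ‖slice x y‖ ≤ ‖x‖ * ‖y‖ * ‖slice x y‖ := by
    have h2 := norm_inner_slice_le (slice x y) x y
    rw [inner_self_eq_norm_sq_to_K, norm_pow, RCLike.norm_ofReal, abs_norm] at h2
    nlinarith [norm_contract_le (slice x y) x, norm_nonneg y]
  exact le_of_mul_le_mul_right h1 (norm_pos_iff.mpr h)

theorem continuous_slice :
    Continuous (slice : EuclideanSpace ℂ (α × β) →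
      EuclideanSpace ℂ α →L[ℂ] EuclideanSpace ℂ β) :=
  LinearMap.continuous_of_finiteDimensional _

theorem abs_sq_norm_slice_sub_le {x y : EuclideanSpace ℂ (α × β)} (hx : ‖x‖ = 1) (hy : ‖y‖ = 1) :
    |‖slice x‖ ^ 2 - ‖slice y‖ ^ 2| ≤ 2 * ‖x - y‖ := by
  have h1 : |‖slice x‖ - ‖slice y‖| ≤ ‖x - y‖ := by
    refine (abs_norm_sub_norm_le _ _).trans ?_
    rw [← map_sub]
    exact norm_slice_le _
  have h2 := norm_slice_le x
  have h3 := norm_slice_le y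
  rw [sq_sub_sq, abs_mul, abs_of_nonneg (by positivity)]
  gcongr
  linarith

/-- An operator between finite-dimensional spaces attains its norm. -/
theorem exists_norm_apply_eq_norm (A : EuclideanSpace ℂ α →L[ℂ] EuclideanSpace ℂ β) :
    ∃ y, ‖y‖ ≤ 1 ∧ ‖A y‖ = ‖A‖ := by
  obtain ⟨y, hy, hmax⟩ := (isCompact_closedBall (0 : EuclideanSpace ℂ α) 1).exists_isMaxOn
    ⟨0, by simp⟩ (f := fun y => ‖A y‖) (by fun_prop)
  rw [mem_closedBall_zero_iff] at hy
  refine ⟨y, hy, le_antisymm (A.unit_le_opNorm y hy) ?_⟩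
  refine ContinuousLinearMap.opNorm_le_of_unit_norm (norm_nonneg _) fun z hz => ?_
  exact hmax (by simp [hz])

/-- This replaces a supremum by an average without a net. At a vector `y` attaining the norm, the
overlap of `slice x y` with a Gaussian `b` has `2t`-th moment `t! ‖slice x‖ ^ (2t)`, and the overlap
is at most `‖contract b x‖`. -/
theorem norm_slice_pow_mul_factorial_le (x : EuclideanSpace ℂ (α × β)) (t : ℕ) :
    ENNReal.ofReal (‖slice x‖ ^ (2 * t)) * (t.factorial : ℕ) ≤
      ∫⁻ b, ENNReal.ofReal (‖contract b x‖ ^ (2 * t)) ∂gaussian (EuclideanSpace ℂ β) := by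
  obtain ⟨y, hy, hxy⟩ := exists_norm_apply_eq_norm (slice x)
  rw [← hxy, ← lintegral_norm_inner_pow_gaussian]
  refine lintegral_mono fun b => ?_
  simp only
  gcongr
  exact (norm_inner_slice_le b x y).trans (mul_le_of_le_one_left (norm_nonneg _) hy)

theorem measurable_norm_contract_pow (t : ℕ) :
    Measurable fun p : EuclideanSpace ℂ (α × β) × EuclideanSpace ℂ β =>
      ENNReal.ofReal (‖contract p.2 p.1‖ ^ (2 * t)) :=
  (ENNReal.continuous_ofReal.comp (continuous_contract.norm.pow _)).measurable

/-- The average of `‖contract b x‖ ^ (2 * t)` over a Gaussian vector `b`. -/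
noncomputable def contractMoment (t : ℕ) (x : EuclideanSpace ℂ (α × β)) : ℝ≥0∞ :=
  ∫⁻ b, ENNReal.ofReal (‖contract b x‖ ^ (2 * t)) ∂gaussian (EuclideanSpace ℂ β)

theorem measurable_contractMoment (t : ℕ) :
    Measurable (contractMoment t : EuclideanSpace ℂ (α × β) → ℝ≥0∞) :=
  (measurable_norm_contract_pow t).lintegral_prod_right'

theorem contractMoment_smul (t : ℕ) {c : ℝ} (hc : 0 ≤ c) (x : EuclideanSpace ℂ (α × β)) :
    contractMoment t ((c : ℂ) • x) = ENNReal.ofReal (c ^ (2 * t)) * contractMoment t x := by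
  have h : ∀ b : EuclideanSpace ℂ β, ENNReal.ofReal (‖contract b ((c : ℂ) • x)‖ ^ (2 * t)) =
      ENNReal.ofReal (c ^ (2 * t)) * ENNReal.ofReal (‖contract b x‖ ^ (2 * t)) := fun b => by
    rw [map_smul, norm_smul, Complex.norm_real, Real.norm_of_nonneg hc, mul_pow,
      ENNReal.ofReal_mul (by positivity)]
  exact (lintegral_congr h).trans (lintegral_const_mul' _ _ ENNReal.ofReal_ne_top)

/-- With the integrals swapped, for fixed `b` the vector `contract b x` is `‖b‖` times a Gaussian on
the first factor, so the moments of the two factors multiply. -/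
theorem lintegral_contractMoment [Nonempty α] [Nonempty β] (t : ℕ) :
    ∫⁻ x, contractMoment t x ∂gaussian (EuclideanSpace ℂ (α × β)) =
      ((Fintype.card α).ascFactorial t * (Fintype.card β).ascFactorial t : ℕ) := by
  have h1 : ∀ b : EuclideanSpace ℂ β, ∫⁻ x, ENNReal.ofReal (‖contract b x‖ ^ (2 * t))
      ∂gaussian (EuclideanSpace ℂ (α × β)) =
      ((Fintype.card α).ascFactorial t : ℕ) * ENNReal.ofReal (‖b‖ ^ (2 * t)) := fun b =>
    (lintegral_norm_pow_map_gaussian (contract b)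
      (fun y => WithLp.toLp 2 fun p : α × β => y p.1 * b p.2) (norm_nonneg b)
      (norm_toLp_mul b) (inner_toLp_mul b) t).trans (mul_comm _ _)
  have h2 := lintegral_lintegral_swap (μ := gaussian (EuclideanSpace ℂ (α × β)))
    (ν := gaussian (EuclideanSpace ℂ β))
    (f := fun x b => ENNReal.ofReal (‖contract b x‖ ^ (2 * t)))
    (measurable_norm_contract_pow t).aemeasurable
  refine h2.trans ((lintegral_congr h1).trans ?_)
  rw [lintegral_const_mul' _ _ (ENNReal.natCast_ne_top _),
    lintegral_norm_pow_gaussian_euclideanSpace β, Nat.cast_mul]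

variable [DecidableEq α] [DecidableEq β]

theorem lintegral_norm_slice_pow_le [Nonempty α] [Nonempty β] {ψ : EuclideanSpace ℂ (α × β)}
    (hψ : ‖ψ‖ = 1) (t : ℕ) :
    (∫⁻ U, ENNReal.ofReal (‖slice (act U⁻¹ ψ)‖ ^ (2 * t)) ∂unitaryHaar (α × β)) *
        (t.factorial * (Fintype.card (α × β)).ascFactorial t : ℕ) ≤
      ((Fintype.card α).ascFactorial t * (Fintype.card β).ascFactorial t : ℕ) := by
  have key := lintegral_unitaryHaar_mul (measurable_contractMoment t) t
    (fun c hc x => contractMoment_smul t hc x) hψ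
  rw [lintegral_norm_pow_gaussian_euclideanSpace (α × β), lintegral_contractMoment] at key
  rw [← key, Nat.cast_mul, ← mul_assoc]
  gcongr
  rw [← lintegral_mul_const' _ _ (ENNReal.natCast_ne_top _)]
  exact lintegral_mono fun U => norm_slice_pow_mul_factorial_le _ t

end Slices

/-! ### Reduced states in terms of slices -/

section ReducedState

variable {α β ι : Type*} [Fintype α] [Fintype ι]

theorem reducedState_apply {α₁ : Type*} [Fintype α₁] [DecidableEq α₁]
    (U : Matrix (α × β) ι ℂ) (ψ : EuclideanSpace ℂ (α₁ × ι)) (b b' : β) :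
    reducedState U ψ b b' =
      ∑ a, ∑ i, (U *ᵥ fun j => ψ (i, j)) (a, b) * star ((U *ᵥ fun j => ψ (i, j)) (a, b')) := by
  have hV : ∀ i p, (((1 : Matrix α₁ α₁ ℂ) ⊗ₖ U) *ᵥ fun q => ψ q) (i, p) =
      (U *ᵥ fun j => ψ (i, j)) p := by
    intro i p
    simp [mulVec, dotProduct, Fintype.sum_prod_type, Matrix.one_apply]
  simp only [reducedState, traceLeft, of_apply, ketBra]
  refine Finset.sum_congr rfl fun a _ => Finset.sum_congr rfl fun i _ => ?_
  rw [mul_vecMulVec, vecMulVec_mul, vecMulVec_apply, hV]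
  congr 1
  have := congrFun (star_mulVec ((1 : Matrix α₁ α₁ ℂ) ⊗ₖ U) fun q => ψ q) (i, a, b')
  rw [Pi.star_apply, hV] at this
  exact this.symm

variable [Fintype β]

theorem adjoint_slice_apply (x : EuclideanSpace ℂ (α × β)) (z : EuclideanSpace ℂ β) (a : α) :
    (slice x).adjoint z a = ∑ b, star (x (a, b)) * z b := by
  have h : (slice x).adjoint z = WithLp.toLp 2 fun a => ∑ b, star (x (a, b)) * z b := by
    refine ext_inner_left ℂ fun y => ?_
    rw [ContinuousLinearMap.adjoint_inner_right]
    simp only [PiLp.inner_apply, slice_apply, RCLike.inner_apply, map_sum, map_mul,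
      Finset.sum_mul, Finset.mul_sum]
    rw [Finset.sum_comm]
    refine Finset.sum_congr rfl fun a _ => Finset.sum_congr rfl fun b _ => ?_
    simp only [starRingEnd_apply]
    ring
  rw [h]

variable [DecidableEq β]

/-- The ancilla basis decomposes the reduced state as a sum of `A A†` with `A` the slice of each
component; apply the triangle inequality and `‖A A†‖ ≤ ‖A‖²`. -/
theorem opNorm_reducedState_le {α₁ : Type*} [Fintype α₁] [DecidableEq α₁]
    (U : Matrix (α × β) ι ℂ) (ψ : EuclideanSpace ℂ (α₁ × ι)) :
    opNorm (reducedState U ψ) ≤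
      ∑ i, ‖slice (WithLp.toLp 2 (U *ᵥ fun j => ψ (i, j)) : EuclideanSpace ℂ (α × β))‖ ^ 2 := by
  set x : α₁ → EuclideanSpace ℂ (α × β) := fun i => WithLp.toLp 2 (U *ᵥ fun j => ψ (i, j))
  have hr : ∀ b b', reducedState U ψ b b' = ∑ a, ∑ i, x i (a, b) * star (x i (a, b')) :=
    reducedState_apply U ψ
  have h : toEuclideanCLM (n := β) (𝕜 := ℂ) (reducedState U ψ) =
      ∑ i, (slice (x i)).comp (slice (x i)).adjoint := by
    ext z b
    rw [_root_.sum_apply, ofLp_toEuclideanCLM, WithLp.ofLp_sum, Finset.sum_apply]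
    simp only [mulVec, dotProduct, hr, ContinuousLinearMap.comp_apply,
      slice_apply, adjoint_slice_apply, Finset.sum_mul, Finset.mul_sum]
    rw [Finset.sum_comm, Finset.sum_comm (s := (Finset.univ : Finset α₁))]
    refine Finset.sum_congr rfl fun a _ => ?_
    rw [Finset.sum_comm]
    refine Finset.sum_congr rfl fun i _ => Finset.sum_congr rfl fun b' _ => ?_
    ring
  rw [opNorm, h]
  refine (norm_sum_le _ _).trans (Finset.sum_le_sum fun i _ => ?_)
  refine (ContinuousLinearMap.opNorm_comp_le _ _).trans_eq ?_
  rw [LinearIsometryEquiv.norm_map, sq]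

end ReducedState

/-! ### Nets of the complex unit sphere -/

section Net

variable {ι : Type*} [Fintype ι]

/-- Cut the real and imaginary coordinates into cells of side `1/M` and keep one unit vector from
each cell that meets the sphere. Each coordinate has `2M + 1` possible floors, the value `M` being
reached at the endpoint `1`. -/
theorem exists_sphere_net (M : ℕ) (hM : 0 < M) :
    ∃ N : Finset (EuclideanSpace ℂ ι), (∀ x ∈ N, ‖x‖ = 1) ∧
      N.card ≤ (2 * M + 1) ^ (2 * Fintype.card ι) ∧
      ∀ x : EuclideanSpace ℂ ι, ‖x‖ = 1 →
        ∃ y ∈ N, ‖x - y‖ ≤ √(2 * Fintype.card ι) / M := by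
  classical
  have hM' : (0 : ℝ) < M := by exact_mod_cast hM
  let f : EuclideanSpace ℂ ι → ι → ℤ × ℤ := fun x i => (⌊M * (x i).re⌋, ⌊M * (x i).im⌋)
  let P : Finset (ι → ℤ × ℤ) :=
    Fintype.piFinset fun _ => Finset.Icc (-M : ℤ) M ×ˢ Finset.Icc (-M : ℤ) M
  have hfloor : ∀ r : ℝ, |r| ≤ 1 → ⌊M * r⌋ ∈ Finset.Icc (-M : ℤ) M := by
    intro r hr
    rw [abs_le] at hr
    rw [Finset.mem_Icc, Int.le_floor]
    refine ⟨by push_cast; nlinarith, ?_⟩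
    have h1 : (⌊M * r⌋ : ℝ) ≤ M := (Int.floor_le _).trans (by nlinarith)
    exact_mod_cast h1
  have hfP : ∀ x, ‖x‖ = 1 → f x ∈ P := by
    intro x hx
    rw [Fintype.mem_piFinset]
    intro i
    have h1 : ‖x i‖ ≤ 1 := hx ▸ PiLp.norm_apply_le x i
    exact Finset.mem_product.mpr ⟨hfloor _ ((Complex.abs_re_le_norm _).trans h1),
      hfloor _ ((Complex.abs_im_le_norm _).trans h1)⟩
  have hdist : ∀ x y, f x = f y → ‖x - y‖ ≤ √(2 * Fintype.card ι) / M := by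
    intro x y hxy
    have hr : ∀ r s : ℝ, ⌊M * r⌋ = ⌊M * s⌋ → (r - s) ^ 2 ≤ 1 / M ^ 2 := by
      intro r s hrs
      have h1 := Int.abs_sub_lt_one_of_floor_eq_floor hrs
      rw [← mul_sub] at h1
      rw [le_div_iff₀ (by positivity), ← mul_pow, mul_comm]
      exact (sq_le_one_iff_abs_le_one _).mpr h1.le
    have hi : ∀ i, ‖(x - y) i‖ ^ 2 ≤ 2 / M ^ 2 := by
      intro i
      have h1 := congrFun hxy i
      have h2 := hr _ _ (Prod.ext_iff.mp h1).1
      have h3 := hr _ _ (Prod.ext_iff.mp h1).2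
      rw [← Complex.normSq_eq_norm_sq, Complex.normSq_apply, PiLp.sub_apply, Complex.sub_re,
        Complex.sub_im]
      calc _ = ((x i).re - (y i).re) ^ 2 + ((x i).im - (y i).im) ^ 2 := by ring
        _ ≤ 1 / M ^ 2 + 1 / M ^ 2 := add_le_add h2 h3
        _ = _ := by ring
    rw [EuclideanSpace.norm_eq]
    refine (Real.sqrt_le_sqrt (Finset.sum_le_sum fun i _ => hi i)).trans_eq ?_
    rw [Finset.sum_const, nsmul_eq_mul, Finset.card_univ,
      show (Fintype.card ι : ℝ) * (2 / M ^ 2) = 2 * Fintype.card ι / M ^ 2 by ring,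
      Real.sqrt_div (by positivity), Real.sqrt_sq hM'.le]
  let T := P.filter fun c => ∃ x, ‖x‖ = 1 ∧ f x = c
  have hT : ∀ c : T, ∃ x, ‖x‖ = 1 ∧ f x = c := fun c => (Finset.mem_filter.mp c.2).2
  choose g hg using hT
  refine ⟨Finset.univ.image g, ?_, ?_, ?_⟩
  · intro x hx
    obtain ⟨c, -, rfl⟩ := Finset.mem_image.mp hx
    exact (hg c).1
  · refine Finset.card_image_le.trans ?_
    rw [Finset.card_univ, Fintype.card_coe]
    refine (Finset.card_filter_le _ _).trans_eq ?_
    simp only [P]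
    rw [Fintype.card_piFinset, Finset.prod_const, Finset.card_univ, Finset.card_product, Int.card_Icc,
      show ((M : ℤ) + 1 - -M).toNat = 2 * M + 1 by omega, ← sq, ← pow_mul]
  · intro x hx
    refine ⟨g ⟨f x, Finset.mem_filter.mpr ⟨hfP x hx, x, hx, rfl⟩⟩,
      Finset.mem_image_of_mem _ (Finset.mem_univ _), hdist _ _ ?_⟩
    rw [(hg _).2]

end Net

/-! ### Selecting good samples from exponential moments -/

section Selection

/-- Sample points are chosen one at a time, each no worse than the mean of the current sum; no
product measure is needed. -/
theorem exists_sum_prod_le {Ω I : Type*} [MeasurableSpace Ω] (μ : Measure Ω)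
    [IsProbabilityMeasure μ] (s : Finset I) (f : I → Ω → ℝ≥0∞) (hf : ∀ i ∈ s, Measurable (f i))
    (C : ℝ≥0∞) (hC : ∀ i ∈ s, ∫⁻ ω, f i ω ∂μ ≤ C) (n : ℕ) :
    ∃ ω : Fin n → Ω, ∑ i ∈ s, ∏ k, f i (ω k) ≤ s.card * C ^ n := by
  induction n with
  | zero => exact ⟨Fin.elim0, by simp⟩
  | succ n ih =>
    obtain ⟨ω, hω⟩ := ih
    have hm : Measurable fun w => ∑ i ∈ s, (∏ k, f i (ω k)) * f i w :=
      Finset.measurable_fun_sum _ fun i hi => (hf i hi).const_mul _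
    obtain ⟨w, hw⟩ := exists_le_lintegral (μ := μ) hm.aemeasurable
    refine ⟨Fin.snoc ω w, ?_⟩
    simp only [Fin.prod_univ_castSucc, Fin.snoc_castSucc, Fin.snoc_last]
    refine hw.trans ?_
    rw [lintegral_finsetSum' _ fun i hi => ((hf i hi).const_mul _).aemeasurable]
    calc ∑ i ∈ s, ∫⁻ w, (∏ k, f i (ω k)) * f i w ∂μ
        ≤ ∑ i ∈ s, (∏ k, f i (ω k)) * C := by
          refine Finset.sum_le_sum fun i hi => ?_
          rw [lintegral_const_mul _ (hf i hi)]
          gcongr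
          exact hC i hi
      _ ≤ s.card * C ^ n * C := by
          rw [← Finset.sum_mul]
          gcongr
      _ = _ := by rw [mul_assoc, pow_succ]

/-- A Chernoff bound with union over `s`: on `[0, 1]` one has `exp g ≤ 1 + 2g`, so each exponential
moment is at most `1 + 2p ≤ exp (2p)`, and any one product is bounded by the sum over `s`. -/
theorem exists_sum_le_log_card_add {Ω I : Type*} [MeasurableSpace Ω] (μ : Measure Ω)
    [IsProbabilityMeasure μ] (s : Finset I) (g : I → Ω → ℝ) (hg : ∀ i ∈ s, Measurable (g i))
    (hg0 : ∀ i ∈ s, ∀ ω, 0 ≤ g i ω) (hg1 : ∀ i ∈ s, ∀ ω, g i ω ≤ 1) {p : ℝ} (hp : 0 ≤ p)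
    (hint : ∀ i ∈ s, ∫⁻ ω, ENNReal.ofReal (g i ω) ∂μ ≤ ENNReal.ofReal p) (n : ℕ) :
    ∃ ω : Fin n → Ω, ∀ i ∈ s, ∑ k, g i (ω k) ≤ Real.log s.card + 2 * p * n := by
  obtain ⟨ω, hω⟩ := exists_sum_prod_le μ s (fun i w => ENNReal.ofReal (Real.exp (g i w)))
    (fun i hi => (Real.measurable_exp.comp (hg i hi)).ennreal_ofReal)
    (ENNReal.ofReal (1 + 2 * p)) (fun i hi => by
      calc ∫⁻ w, ENNReal.ofReal (Real.exp (g i w)) ∂μ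
          ≤ ∫⁻ w, (1 + ENNReal.ofReal 2 * ENNReal.ofReal (g i w)) ∂μ := by
            refine lintegral_mono fun w => ?_
            rw [← ENNReal.ofReal_mul (by norm_num), ← ENNReal.ofReal_one,
              ← ENNReal.ofReal_add zero_le_one (by have := hg0 i hi w; positivity)]
            refine ENNReal.ofReal_le_ofReal ?_
            have h0 := hg0 i hi w
            have h1 := hg1 i hi w
            have h2 := (abs_le.mp (Real.abs_exp_sub_one_sub_id_le
              (abs_le.mpr ⟨by linarith, h1⟩))).2
            nlinarith
        _ = 1 + ENNReal.ofReal 2 * ∫⁻ w, ENNReal.ofReal (g i w) ∂μ := by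
            rw [lintegral_add_left measurable_const,
              lintegral_const_mul _ (hg i hi).ennreal_ofReal]
            simp
        _ ≤ 1 + ENNReal.ofReal 2 * ENNReal.ofReal p := by gcongr; exact hint i hi
        _ = ENNReal.ofReal (1 + 2 * p) := by
            rw [ENNReal.ofReal_add zero_le_one (by positivity), ENNReal.ofReal_mul (by norm_num),
              ENNReal.ofReal_one]) n
  refine ⟨ω, fun i hi => ?_⟩
  have h1 := (Finset.single_le_sum (f := fun i => ∏ k, ENNReal.ofReal (Real.exp (g i (ω k))))
    (fun _ _ => zero_le) hi).trans hω
  rw [← ENNReal.ofReal_prod_of_nonneg fun k _ => (Real.exp_pos _).le, ← Real.exp_sum,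
    ← ENNReal.ofReal_natCast, ← ENNReal.ofReal_pow (by positivity),
    ← ENNReal.ofReal_mul (by positivity), ENNReal.ofReal_le_ofReal_iff (by positivity)] at h1
  have hs : (0 : ℝ) < s.card := by exact_mod_cast Finset.card_pos.mpr ⟨i, hi⟩
  have h2 : (1 + 2 * p) ^ n ≤ Real.exp (2 * p * n) := by
    rw [mul_comm (2 * p), Real.exp_nat_mul]
    gcongr
    linarith [Real.add_one_le_exp (2 * p)]
  rw [← Real.exp_le_exp, Real.exp_add, Real.exp_log hs]
  exact h1.trans (by gcongr)

end Selection

/-! ### The excess of the largest eigenvalue over a threshold -/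

section Excess

variable {α β : Type*} [Fintype α] [Fintype β]

theorem sq_norm_slice_le_one {x : EuclideanSpace ℂ (α × β)} (hx : ‖x‖ = 1) :
    ‖slice x‖ ^ 2 ≤ 1 :=
  pow_le_one₀ (norm_nonneg _) (hx ▸ norm_slice_le x)

variable [DecidableEq α] [DecidableEq β]

/-- The amount by which the largest eigenvalue of the reduced state of `U⁻¹ ψ` exceeds `c`. -/
noncomputable def excess (c : ℝ) (ψ : EuclideanSpace ℂ (α × β)) (U : unitaryGroup (α × β) ℂ) : ℝ :=
  max 0 (‖slice (act U⁻¹ ψ)‖ ^ 2 - c)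

theorem excess_nonneg (c : ℝ) (ψ : EuclideanSpace ℂ (α × β)) (U : unitaryGroup (α × β) ℂ) :
    0 ≤ excess c ψ U := le_max_left _ _

theorem excess_le_one {c : ℝ} (hc : 0 ≤ c) {ψ : EuclideanSpace ℂ (α × β)} (hψ : ‖ψ‖ = 1)
    (U : unitaryGroup (α × β) ℂ) : excess c ψ U ≤ 1 := by
  refine max_le zero_le_one ?_
  linarith [sq_norm_slice_le_one ((norm_act U⁻¹ ψ).trans hψ)]

theorem excess_le_add (c : ℝ) {ψ φ : EuclideanSpace ℂ (α × β)} (hψ : ‖ψ‖ = 1) (hφ : ‖φ‖ = 1)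
    (U : unitaryGroup (α × β) ℂ) : excess c ψ U ≤ excess c φ U + 2 * ‖ψ - φ‖ := by
  have h := (abs_le.mp (abs_sq_norm_slice_sub_le ((norm_act U⁻¹ ψ).trans hψ)
    ((norm_act U⁻¹ φ).trans hφ))).2
  rw [← map_sub, norm_act] at h
  have h1 : ‖slice (act U⁻¹ φ)‖ ^ 2 - c ≤ excess c φ U := le_max_right _ _
  refine max_le ?_ (by linarith)
  have := excess_nonneg c φ U
  positivity

theorem measurable_excess (c : ℝ) (ψ : EuclideanSpace ℂ (α × β)) : Measurable (excess c ψ) := by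
  have h : Continuous fun U : unitaryGroup (α × β) ℂ => slice (act U⁻¹ ψ) :=
    continuous_slice.comp (continuous_act_inv ψ)
  exact (continuous_const.max ((h.norm.pow 2).sub continuous_const)).measurable

/-- Since the eigenvalue `s` is at most `1`, its excess over `c` is at most `(s/c)ᵗ`: either `s ≤ c`
and the excess is zero, or the power is at least `1`. -/
theorem lintegral_excess_le [Nonempty α] [Nonempty β] {c : ℝ} (hc : 0 < c)
    {ψ : EuclideanSpace ℂ (α × β)} (hψ : ‖ψ‖ = 1) (t : ℕ) :
    ∫⁻ U, ENNReal.ofReal (excess c ψ U) ∂unitaryHaar (α × β) ≤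
      ENNReal.ofReal ((c ^ t)⁻¹ * ((Fintype.card α).ascFactorial t *
        (Fintype.card β).ascFactorial t /
          (t.factorial * (Fintype.card α * Fintype.card β).ascFactorial t))) := by
  have h1 : ∀ U, ENNReal.ofReal (excess c ψ U) ≤
      ENNReal.ofReal (c ^ t)⁻¹ * ENNReal.ofReal (‖slice (act U⁻¹ ψ)‖ ^ (2 * t)) := by
    intro U
    rw [← ENNReal.ofReal_mul (by positivity)]
    refine ENNReal.ofReal_le_ofReal (max_le (by positivity) ?_)
    rw [pow_mul, ← inv_pow, ← mul_pow]
    have h2 := sq_norm_slice_le_one ((norm_act U⁻¹ ψ).trans hψ)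
    rcases le_total (‖slice (act U⁻¹ ψ)‖ ^ 2) c with h | h
    · have : 0 ≤ (c⁻¹ * ‖slice (act U⁻¹ ψ)‖ ^ 2) ^ t := by positivity
      linarith
    · have : 1 ≤ (c⁻¹ * ‖slice (act U⁻¹ ψ)‖ ^ 2) ^ t := by
        refine one_le_pow₀ ?_
        rw [inv_mul_eq_div, le_div_iff₀ hc]
        linarith
      linarith
  refine (lintegral_mono h1).trans ?_
  rw [lintegral_const_mul' _ _ ENNReal.ofReal_ne_top, ENNReal.ofReal_mul (by positivity)]
  gcongr
  have hpos : 0 < t.factorial * (Fintype.card α * Fintype.card β).ascFactorial t := by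
    have := Fintype.card_pos (α := α)
    have := Fintype.card_pos (α := β)
    obtain ⟨k, hk⟩ : ∃ k, Fintype.card α * Fintype.card β = k + 1 :=
      Nat.exists_eq_add_one.mpr (by positivity)
    rw [hk]
    exact Nat.mul_pos (Nat.factorial_pos t) (Nat.ascFactorial_pos k t)
  have h3 := lintegral_norm_slice_pow_le hψ t
  rw [Fintype.card_prod] at h3
  have h4 := (ENNReal.le_div_iff_mul_le (Or.inl (by exact_mod_cast hpos.ne'))
    (Or.inl (ENNReal.natCast_ne_top _))).mpr h3
  refine h4.trans_eq ?_
  rw [← ENNReal.ofReal_natCast, ← ENNReal.ofReal_natCast, ← ENNReal.ofReal_div_of_pos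
    (by exact_mod_cast hpos)]
  push_cast
  rfl

end Excess

/-! ### Numerical bounds on the moment ratio -/

section Estimates

/-- Factor by factor, `(a + s) d / (ad + s) ≤ 1 + s/a ≤ exp (s/a)`, and the exponents for `s < t`
sum to at most `t²/(2a)`. -/
theorem ascFactorial_mul_pow_le {a : ℕ} (ha : 0 < a) (d t : ℕ) :
    (a.ascFactorial t : ℝ) * (d : ℝ) ^ t ≤
      (a * d).ascFactorial t * Real.exp ((t : ℝ) ^ 2 / (2 * a)) := by
  have ha' : (0 : ℝ) < a := by exact_mod_cast ha
  induction t with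
  | zero => simp
  | succ t ih =>
    have h1 : ((a : ℝ) + t) * d ≤
        (a * d + t) * Real.exp (((t + 1 : ℝ) ^ 2 - t ^ 2) / (2 * a)) := by
      calc ((a : ℝ) + t) * d = a * d * (t / a + 1) := by field_simp; ring
        _ ≤ a * d * Real.exp (t / a) := by gcongr; exact Real.add_one_le_exp _
        _ ≤ _ := by
          refine mul_le_mul (by simp) (Real.exp_le_exp.mpr ?_) (Real.exp_pos _).le
            (by positivity)
          rw [div_le_div_iff₀ ha' (by positivity)]
          nlinarith
    rw [Nat.ascFactorial_succ, Nat.ascFactorial_succ, pow_succ]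
    push_cast
    calc ((a : ℝ) + t) * a.ascFactorial t * (d ^ t * d)
        = ((a + t) * d) * (a.ascFactorial t * d ^ t) := by ring
      _ ≤ ((a * d + t) * Real.exp (((t + 1 : ℝ) ^ 2 - t ^ 2) / (2 * a))) *
          ((a * d).ascFactorial t * Real.exp ((t : ℝ) ^ 2 / (2 * a))) := by gcongr
      _ = (a * d + t) * (a * d).ascFactorial t *
          (Real.exp (((t + 1 : ℝ) ^ 2 - t ^ 2) / (2 * a)) *
            Real.exp ((t : ℝ) ^ 2 / (2 * a))) := by ring
      _ = _ := by
        rw [← Real.exp_add]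
        congr 2
        ring

/-- The quotient by `t!` is a binomial coefficient, which by symmetry chooses only `d - 1` elements
and so is polynomial in `t`. -/
theorem ascFactorial_le_factorial_mul_pow {d : ℕ} (hd : 0 < d) (t : ℕ) :
    d.ascFactorial t ≤ t.factorial * (d + t) ^ d := by
  obtain ⟨k, rfl⟩ : ∃ k, d = k + 1 := Nat.exists_eq_add_one.mpr hd
  rw [Nat.ascFactorial_eq_factorial_mul_choose, ← Nat.choose_symm_add]
  gcongr
  calc (k + t).choose k ≤ (k + t) ^ k := Nat.choose_le_pow _ _
    _ ≤ (k + 1 + t) ^ k := by gcongr; omega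
    _ ≤ (k + 1 + t) ^ (k + 1) := Nat.pow_le_pow_right (by omega) (by omega)

theorem exp_mul_le_one_add_half {ε : ℝ} (hε : 0 ≤ ε) (hε1 : ε ≤ 1) :
    Real.exp (35 / 100 * ε) ≤ 1 + ε / 2 := by
  have h := (abs_le.mp (Real.abs_exp_sub_one_sub_id_le (x := 35 / 100 * ε)
    (abs_le.mpr ⟨by linarith, by linarith⟩))).2
  nlinarith

theorem log_natCast_ge_two {d : ℕ} (hd : 10 ≤ d) : 2 ≤ Real.log d := by
  have hd' : (10 : ℝ) ≤ d := by exact_mod_cast hd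
  rw [Real.le_log_iff_exp_le (by linarith), show (2 : ℝ) = 1 + 1 by norm_num, Real.exp_add]
  nlinarith [Real.exp_one_lt_d9, Real.exp_pos 1]

theorem moment_bound_le {ε : ℝ} (hε : 0 < ε) (hε1 : ε ≤ 1) {d a : ℕ} (hd : 10 / ε ≤ (d : ℝ))
    (ha1 : 112 * (d * Real.log d) / ε ^ 2 ≤ a) (ha2 : a ≤ 112 * (d * Real.log d) / ε ^ 2 + 1) :
    ∃ t : ℕ, (((1 + ε / 2) / d) ^ t)⁻¹ * ((a.ascFactorial t : ℝ) * d.ascFactorial t /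
      (t.factorial * (a * d).ascFactorial t)) ≤ 1 / (d : ℝ) ^ 3 := by
  have hdε : 10 ≤ d * ε := (div_le_iff₀ hε).mp hd
  have hd10 : (10 : ℝ) ≤ d := by nlinarith
  have hd10' : 10 ≤ d := by exact_mod_cast hd10
  have hd0 : (0 : ℝ) < d := by linarith
  have hlog := log_natCast_ge_two hd10'
  have hlogd : Real.log d ≤ d := (Real.log_le_sub_one_of_pos hd0).trans (by linarith)
  have hεa : 112 * (d * Real.log d) ≤ ε ^ 2 * a := by
    rwa [div_le_iff₀' (by positivity)] at ha1
  have ha1' : (1 : ℝ) ≤ a := by nlinarith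
  have ha0 : 0 < a := by exact_mod_cast ha1'
  have had0 : 0 < a * d := Nat.mul_pos ha0 (by omega)
  set τ : ℝ := 35 / 100 * ε * a with hτ
  have hτ0 : 0 ≤ τ := by positivity
  -- `τ` minimises `t²/(2a) - 0.35 ε t`, the exponent left by the two bounds on powers of `t`;
  -- `0.35` is a rate for which `exp (0.35 ε) ≤ 1 + ε/2`.
  refine ⟨⌈τ⌉₊, ?_⟩
  set t := ⌈τ⌉₊ with ht
  have ht1 : τ ≤ t := Nat.le_ceil τ
  have ht2 : (t : ℝ) < τ + 1 := Nat.ceil_lt_add_one hτ0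
  -- Here `1/ε ≤ d/10` makes `t` polynomial in `d`, so that `(d + t)ᵈ` costs only `4 d log d` in the
  -- exponent.
  have htd : (d : ℝ) + t ≤ d ^ 4 := by
    have h1 : ε * a ≤ 112 * (d * Real.log d) / ε + 1 := by
      have h2 : ε * a ≤ ε * (112 * (d * Real.log d) / ε ^ 2 + 1) := by gcongr
      have h3 : ε * (112 * (d * Real.log d) / ε ^ 2 + 1) =
          112 * (d * Real.log d) / ε + ε := by field_simp
      linarith
    have h4 : 112 * (d * Real.log d) / ε ≤ 112 / 10 * (d : ℝ) ^ 3 := by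
      rw [div_le_iff₀ hε]
      have h5 : (d : ℝ) * Real.log d ≤ d ^ 2 := by nlinarith
      have h6 : (d : ℝ) ^ 2 * 10 ≤ d ^ 2 * (d * ε) := by gcongr
      nlinarith
    have h7 : (1000 : ℝ) ≤ d ^ 3 := by
      calc (1000 : ℝ) = 10 ^ 3 := by norm_num
        _ ≤ d ^ 3 := by gcongr
    have h8 : (d : ℝ) ^ 4 = d ^ 3 * d := by ring
    have h9 : (d : ℝ) ≤ d ^ 3 := by nlinarith
    nlinarith
  have hA := ascFactorial_mul_pow_le ha0 d t
  have hB : (d.ascFactorial t : ℝ) ≤ t.factorial * (d + t) ^ d := by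
    exact_mod_cast ascFactorial_le_factorial_mul_pow (by omega) t
  have hasc : (0 : ℝ) < (a * d).ascFactorial t := by
    obtain ⟨k, hk⟩ := Nat.exists_eq_add_one.mpr had0
    rw [hk]
    exact_mod_cast Nat.ascFactorial_pos k t
  have hfac : (0 : ℝ) < t.factorial := by exact_mod_cast Nat.factorial_pos t
  have hC : (1 + ε / 2) ^ t ≥ Real.exp (35 / 100 * ε * t) := by
    rw [mul_comm, Real.exp_nat_mul]
    gcongr
    exact exp_mul_le_one_add_half hε.le hε1
  have hD : ((d : ℝ) + t) ^ d ≤ Real.exp (4 * (d * Real.log d)) := by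
    calc ((d : ℝ) + t) ^ d ≤ (d ^ 4) ^ d := by gcongr
      _ = Real.exp (4 * (d * Real.log d)) := by
        rw [← pow_mul, show 4 * ((d : ℝ) * Real.log d) = ((4 * d : ℕ) : ℝ) * Real.log d by
          push_cast; ring, Real.exp_nat_mul, Real.exp_log hd0]
  have hexp : (t : ℝ) ^ 2 / (2 * a) + 4 * (d * Real.log d) - 35 / 100 * ε * t ≤
      -(3 * Real.log d) := by
    have h1 : (t : ℝ) ^ 2 / (2 * a) - 35 / 100 * ε * t =
        ((t - τ) ^ 2 - τ ^ 2) / (2 * a) := by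
      rw [hτ]; field_simp; ring
    have h2 : ((t - τ) ^ 2 - τ ^ 2) / (2 * a) ≤ (1 - τ ^ 2) / (2 * a) := by
      gcongr
      nlinarith
    have h3 : (1 - τ ^ 2) / (2 * a) = 1 / (2 * a) - 1225 / 20000 * (ε ^ 2 * a) := by
      rw [hτ]; field_simp; ring
    have h4 : 1 / (2 * (a : ℝ)) ≤ 1 := by
      rw [div_le_one (by positivity)]; linarith
    -- The gain is `0.06125 ε² a ≥ 6.86 d log d`, against a cost of `4 d log d + 1`; `d ≥ 10` turns
    -- the surplus into `3 log d`.
    nlinarith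
  calc (((1 + ε / 2) / d) ^ t)⁻¹ * ((a.ascFactorial t : ℝ) * d.ascFactorial t /
        (t.factorial * (a * d).ascFactorial t))
      = (a.ascFactorial t * d ^ t) * d.ascFactorial t /
        ((1 + ε / 2) ^ t * (t.factorial * (a * d).ascFactorial t)) := by
        rw [div_pow]; field_simp
    _ ≤ ((a * d).ascFactorial t * Real.exp ((t : ℝ) ^ 2 / (2 * a))) *
        (t.factorial * Real.exp (4 * (d * Real.log d))) /
        (Real.exp (35 / 100 * ε * t) * (t.factorial * (a * d).ascFactorial t)) := by
        gcongr
        exact hB.trans (by gcongr)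
    _ = Real.exp ((t : ℝ) ^ 2 / (2 * a) + 4 * (d * Real.log d) - 35 / 100 * ε * t) := by
        rw [Real.exp_sub, Real.exp_add]; field_simp
    _ ≤ Real.exp (-(3 * Real.log d)) := Real.exp_le_exp.mpr hexp
    _ = 1 / (d : ℝ) ^ 3 := by
        rw [Real.exp_neg, show 3 * Real.log d = ((3 : ℕ) : ℝ) * Real.log d by norm_num,
          Real.exp_nat_mul, Real.exp_log hd0, one_div]

end Estimates

/-! ### Unitaries with small total excess at every unit vector -/

section RandomUnitaries

theorem exists_unitaries_sum_excess_le {ε : ℝ} (hε : 0 < ε) (hε1 : ε ≤ 1) {d a n : ℕ}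
    (hd : 10 / ε ≤ (d : ℝ)) (ha1 : 112 * (d * Real.log d) / ε ^ 2 ≤ a)
    (ha2 : a ≤ 112 * (d * Real.log d) / ε ^ 2 + 1)
    (hn : 13440 * ((d : ℝ) ^ 3 * Real.log d ^ 2) / ε ^ 5 ≤ n) :
    ∃ W : Fin n → unitaryGroup (Fin a × Fin d) ℂ, ∀ ψ : EuclideanSpace ℂ (Fin a × Fin d),
      ‖ψ‖ = 1 → ∑ k, excess ((1 + ε / 2) / d) ψ (W k) ≤ n * (ε ^ 2 / (2 * d)) := by
  have hdε : 10 ≤ d * ε := (div_le_iff₀ hε).mp hd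
  have hd10 : (10 : ℝ) ≤ d := by nlinarith
  have hd10' : 10 ≤ d := by exact_mod_cast hd10
  have hd0 : (0 : ℝ) < d := by linarith
  have hlog := log_natCast_ge_two hd10'
  have hlogd : Real.log d ≤ d := (Real.log_le_sub_one_of_pos hd0).trans (by linarith)
  have hεa : 112 * (d * Real.log d) ≤ ε ^ 2 * a := by
    rwa [div_le_iff₀' (by positivity)] at ha1
  have hεa2 : ε ^ 2 * a ≤ 113 * (d * Real.log d) := by
    have h1 : ε ^ 2 * a ≤ ε ^ 2 * (112 * (d * Real.log d) / ε ^ 2 + 1) := by gcongr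
    have h2 : ε ^ 2 * (112 * (d * Real.log d) / ε ^ 2 + 1) =
        112 * (d * Real.log d) + ε ^ 2 := by field_simp
    nlinarith
  have ha1' : (1 : ℝ) ≤ a := by nlinarith
  have : NeZero a := ⟨by rintro rfl; norm_num at ha1'⟩
  have : NeZero d := ⟨by omega⟩
  have hc : 0 < (1 + ε / 2) / d := by positivity
  have hgap : 100 / (d : ℝ) ^ 3 ≤ ε ^ 2 / d := by
    rw [div_le_div_iff₀ (by positivity) hd0]
    have : (10 : ℝ) ^ 2 ≤ (d * ε) ^ 2 := by gcongr
    nlinarith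
  obtain ⟨t, ht⟩ := moment_bound_le hε hε1 hd ha1 ha2
  -- Resolution `d⁶` makes the mesh at most `1/d³`, matching the mean excess, while `log N.card`
  -- stays at most `14 a d log d`.
  obtain ⟨N, hN1, hNcard, hNnet⟩ := exists_sphere_net (ι := Fin a × Fin d) (d ^ 6) (by positivity)
  obtain ⟨W, hW⟩ := exists_sum_le_log_card_add (unitaryHaar (Fin a × Fin d)) N
    (fun φ => excess ((1 + ε / 2) / d) φ) (fun φ _ => measurable_excess _ φ)
    (fun φ _ => excess_nonneg _ φ) (fun φ hφ => excess_le_one hc.le (hN1 φ hφ))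
    (p := 1 / (d : ℝ) ^ 3) (by positivity)
    (fun φ hφ => by
      refine (lintegral_excess_le hc (hN1 φ hφ) t).trans (ENNReal.ofReal_le_ofReal ?_)
      simpa only [Fintype.card_fin] using ht) n
  refine ⟨W, fun ψ hψ => ?_⟩
  obtain ⟨φ, hφN, hφ⟩ := hNnet ψ hψ
  have hcardpos : 0 < N.card := Finset.card_pos.mpr ⟨φ, hφN⟩
  have hlogN : Real.log N.card ≤ 14 * (a * d) * Real.log d := by
    have h1 : (N.card : ℝ) ≤ ((d ^ 7 : ℕ) : ℝ) ^ (2 * (a * d)) := by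
      have h2 : 2 * d ^ 6 + 1 ≤ d ^ 7 := by
        have : 1 ≤ d ^ 6 := Nat.one_le_pow _ _ (by omega)
        rw [pow_succ]
        nlinarith
      have h3 := hNcard.trans (Nat.pow_le_pow_left h2 _)
      rw [Fintype.card_prod, Fintype.card_fin, Fintype.card_fin] at h3
      exact_mod_cast h3
    refine (Real.log_le_log (by exact_mod_cast hcardpos) h1).trans_eq ?_
    rw [Real.log_pow, Nat.cast_pow, Real.log_pow]
    push_cast
    ring
  -- The size of `n` is fixed here: `13440 · 0.12 = 1612.8` exceeds `14 · 113 = 1582`, where `113`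
  -- bounds `ε² a / (d log d)`.
  have hlogN' : 14 * (a * d) * Real.log d ≤ n * (12 / 100 * (ε ^ 2 / d)) := by
    have h1 : n * (12 / 100 * (ε ^ 2 / d)) ≥
        13440 * ((d : ℝ) ^ 3 * Real.log d ^ 2) / ε ^ 5 * (12 / 100 * (ε ^ 2 / d)) := by gcongr
    have h2 : 13440 * ((d : ℝ) ^ 3 * Real.log d ^ 2) / ε ^ 5 * (12 / 100 * (ε ^ 2 / d)) =
        1612.8 * (d ^ 2 * Real.log d ^ 2) / ε ^ 3 := by field_simp; ring
    have h3 : 14 * (a * d) * Real.log d ≤ 1612.8 * (d ^ 2 * Real.log d ^ 2) / ε ^ 3 := by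
      rw [le_div_iff₀ (by positivity)]
      calc 14 * (a * d) * Real.log d * ε ^ 3 = 14 * d * Real.log d * (ε ^ 2 * a) * ε := by ring
        _ ≤ 14 * d * Real.log d * (113 * (d * Real.log d)) * 1 := by gcongr
        _ ≤ 1612.8 * (d ^ 2 * Real.log d ^ 2) := by
          have : 0 ≤ (d : ℝ) ^ 2 * Real.log d ^ 2 := by positivity
          nlinarith
    linarith
  have hdist : ‖ψ - φ‖ ≤ 1 / (d : ℝ) ^ 3 := by
    refine hφ.trans ?_
    have h1 : √(2 * (Fintype.card (Fin a × Fin d) : ℕ)) ≤ (d : ℝ) ^ 3 := by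
      rw [Real.sqrt_le_left (by positivity), Fintype.card_prod, Fintype.card_fin, Fintype.card_fin]
      push_cast
      have h2 : (100 : ℝ) * a ≤ 113 * d ^ 4 := by
        have h3 : (10 : ℝ) ^ 2 * a ≤ (d * ε) ^ 2 * a := by gcongr
        have h4 : (d * ε) ^ 2 * a = d ^ 2 * (ε ^ 2 * a) := by ring
        have h5 : (d : ℝ) ^ 2 * (ε ^ 2 * a) ≤ d ^ 2 * (113 * (d * d)) := by
          refine mul_le_mul_of_nonneg_left (hεa2.trans ?_) (by positivity)
          gcongr
        nlinarith
      have h6 : (d : ℝ) ^ 5 * 10 ≤ d ^ 5 * d := by gcongr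
      have h7 : (100 : ℝ) * a * d ≤ 113 * d ^ 4 * d := by gcongr
      have h8 : (0 : ℝ) ≤ d ^ 5 := by positivity
      nlinarith
    calc _ ≤ (d : ℝ) ^ 3 / ((d ^ 6 : ℕ) : ℝ) := by gcongr
      _ = 1 / (d : ℝ) ^ 3 := by push_cast; field_simp
  calc ∑ k, excess ((1 + ε / 2) / d) ψ (W k)
      ≤ ∑ k, (excess ((1 + ε / 2) / d) φ (W k) + 2 * (1 / (d : ℝ) ^ 3)) := by
        refine Finset.sum_le_sum fun k _ => ?_
        refine (excess_le_add _ hψ (hN1 φ hφN) (W k)).trans ?_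
        gcongr
    _ = ∑ k, excess ((1 + ε / 2) / d) φ (W k) + n * (2 * (1 / (d : ℝ) ^ 3)) := by
        rw [Finset.sum_add_distrib]; simp
    _ ≤ (Real.log N.card + 2 * (1 / (d : ℝ) ^ 3) * n) + n * (2 * (1 / (d : ℝ) ^ 3)) := by
        gcongr
        exact hW φ hφN
    -- The four copies of `n/d³` are two from the mean excess and two from the Lipschitz error; with
    -- `0.12 + 0.04` the total is well below the `1/2` required.
    _ ≤ n * (12 / 100 * (ε ^ 2 / d)) + n * (4 / 100 * (100 / (d : ℝ) ^ 3)) := by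
        have : n * (4 / 100 * (100 / (d : ℝ) ^ 3)) =
          2 * (1 / (d : ℝ) ^ 3) * n + n * (2 * (1 / (d : ℝ) ^ 3)) := by ring
        linarith
    _ ≤ n * (12 / 100 * (ε ^ 2 / d)) + n * (4 / 100 * (ε ^ 2 / d)) := by gcongr
    _ ≤ n * (ε ^ 2 / (2 * d)) := by
        rw [← mul_add]
        gcongr
        have h1 : ε ^ 2 / (2 * d) = 1 / 2 * (ε ^ 2 / d) := by ring
        have h2 : 0 ≤ ε ^ 2 / d := by positivity
        rw [h1]
        linarith

end RandomUnitaries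

/-! ### Isometries as column restrictions of unitaries -/

section Isometries

variable {α β : Type*} [Fintype α] [Fintype β] [DecidableEq α] [DecidableEq β]

theorem exists_unit_smul_eq {ι : Type*} [Fintype ι] [Nonempty ι] (x : EuclideanSpace ℂ ι) :
    ∃ φ : EuclideanSpace ℂ ι, ‖φ‖ = 1 ∧ x = ((‖x‖ : ℝ) : ℂ) • φ := by
  classical
  by_cases hx : x = 0
  · exact ⟨EuclideanSpace.single (Classical.arbitrary ι) 1, by simp, by simp [hx]⟩
  · refine ⟨((‖x‖⁻¹ : ℝ) : ℂ) • x, by simp [norm_smul, hx], ?_⟩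
    rw [smul_smul]
    simp [hx]

theorem sq_norm_slice_le_of_eq_smul (c : ℝ) {x φ : EuclideanSpace ℂ (α × β)}
    (hφ : x = ((‖x‖ : ℝ) : ℂ) • φ) (U : unitaryGroup (α × β) ℂ) :
    ‖slice (act U⁻¹ x)‖ ^ 2 ≤ ‖x‖ ^ 2 * c + ‖x‖ ^ 2 * excess c φ U := by
  have h1 : ‖slice (act U⁻¹ x)‖ ^ 2 = ‖x‖ ^ 2 * ‖slice (act U⁻¹ φ)‖ ^ 2 := by
    conv_lhs => rw [hφ]
    rw [map_smul, map_smul, norm_smul, Complex.norm_real, norm_norm, mul_pow]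
  have h2 : ‖slice (act U⁻¹ φ)‖ ^ 2 - c ≤ excess c φ U := le_max_right _ _
  rw [h1, ← mul_add]
  gcongr
  linarith

/-- The columns of a unitary matrix indexed by the image of an embedding. -/
def restrictColumns {κ ι : Type*} [Fintype κ] [DecidableEq κ] (U : unitaryGroup κ ℂ) (e : ι ↪ κ) :
    Matrix κ ι ℂ :=
  (U : Matrix κ κ ℂ).submatrix id e

theorem isIsometry_restrictColumns {κ ι : Type*} [Fintype κ] [DecidableEq κ] [DecidableEq ι]
    (U : unitaryGroup κ ℂ) (e : ι ↪ κ) :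
    IsIsometry (restrictColumns U e) := by
  have h : (U : Matrix κ κ ℂ)ᴴ * (U : Matrix κ κ ℂ) = 1 := mem_unitaryGroup_iff'.mp U.2
  rw [IsIsometry, restrictColumns, conjTranspose_submatrix,
    ← submatrix_mul _ _ e id e Function.bijective_id, h]
  exact submatrix_one e e.injective

/-- Extension by zero `ℂ^ι → ℂ^κ` along an embedding `ι ↪ κ`. -/
noncomputable def extendByZero {κ ι : Type*} (e : ι ↪ κ) (v : ι → ℂ) : EuclideanSpace ℂ κ :=
  WithLp.toLp 2 (Function.extend e v 0)

theorem sq_norm_extendByZero {κ ι : Type*} [Fintype κ] [Fintype ι] (e : ι ↪ κ) (v : ι → ℂ) :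
    ‖extendByZero e v‖ ^ 2 = ∑ j, ‖v j‖ ^ 2 := by
  rw [EuclideanSpace.norm_sq_eq]
  symm
  refine Fintype.sum_of_injective e e.injective _ _ (fun p hp => ?_) fun j => ?_
  · simp [extendByZero, Function.extend_apply' v (0 : κ → ℂ) p hp]
  · simp [extendByZero, e.injective.extend_apply]

theorem restrictColumns_mulVec_eq_act {κ ι : Type*} [Fintype κ] [Fintype ι] [DecidableEq κ]
    (U : unitaryGroup κ ℂ) (e : ι ↪ κ) (v : ι → ℂ) :
    WithLp.toLp 2 (restrictColumns U e *ᵥ v) = act U (extendByZero e v) := by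
  ext p
  rw [act, ofLp_toEuclideanCLM]
  simp only [mulVec, dotProduct, restrictColumns, submatrix_apply, id]
  refine Fintype.sum_of_injective e e.injective _ _ (fun q hq => ?_) fun j => ?_
  · simp [extendByZero, Function.extend_apply' v (0 : κ → ℂ) q hq]
  · simp [extendByZero, e.injective.extend_apply]

end Isometries

/-! ### Constants of the statement and the count of bad isometries -/

theorem dimA₂_bounds {ε : ℝ} (hε : 0 < ε) {d : ℕ} (hd : 10 ≤ d) :
    112 * (d * Real.log d) / ε ^ 2 ≤ dimA₂ ε d ∧
      dimA₂ ε d ≤ 112 * (d * Real.log d) / ε ^ 2 + 1 := by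
  have hlog := log_natCast_ge_two hd
  have h2 : Real.log 2 ≠ 0 := (Real.log_pos one_lt_two).ne'
  have h : 112 * Real.log 2 / ε ^ 2 * (d * Real.logb 2 d) = 112 * (d * Real.log d) / ε ^ 2 := by
    rw [Real.logb]; field_simp
  rw [dimA₂, h]
  exact ⟨Nat.le_ceil _, (Nat.ceil_lt_add_one (by positivity)).le⟩

theorem le_numIsometries {ε : ℝ} (hε : 0 < ε) (d : ℕ) :
    13440 * ((d : ℝ) ^ 3 * Real.log d ^ 2) / ε ^ 5 ≤ numIsometries ε d := by
  have h2 : Real.log 2 ≠ 0 := (Real.log_pos one_lt_two).ne'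
  have h : 13440 * Real.log 2 ^ 2 / ε ^ 5 * ((d : ℝ) ^ 3 * Real.logb 2 d ^ 2) =
      13440 * ((d : ℝ) ^ 3 * Real.log d ^ 2) / ε ^ 5 := by
    rw [Real.logb]; field_simp
  rw [numIsometries, h]
  exact Nat.le_ceil _

/-- The components of `ψ` along the ancilla basis have squared norms summing to `1`; with these
weights the operator norm is at most `c` plus a weighted mean of excesses. Summing over `k` first
uses `hW` at each normalised component, and Markov's inequality bounds the count. -/
theorem card_filter_le_of_sum_excess_le {ε : ℝ} (hε : 0 < ε) {d a n m r : ℕ} (hd : 0 < d)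
    (ha : 0 < a) (W : Fin n → unitaryGroup (Fin a × Fin d) ℂ) (e : Fin m ↪ Fin a × Fin d)
    (hW : ∀ φ : EuclideanSpace ℂ (Fin a × Fin d),
      ‖φ‖ = 1 → ∑ k, excess ((1 + ε / 2) / d) φ (W k) ≤ n * (ε ^ 2 / (2 * d)))
    (ψ : EuclideanSpace ℂ (Fin r × Fin m)) (hψ : ‖ψ‖ = 1) :
    ((Finset.univ.filter fun k => ¬ opNorm (reducedState (restrictColumns (W k)⁻¹ e) ψ)
        < (1 + ε) / d).card : ℝ) ≤ n * ε := by
  have : NeZero a := ⟨ha.ne'⟩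
  have : NeZero d := ⟨hd.ne'⟩
  have hd0 : (0 : ℝ) < d := by exact_mod_cast hd
  set c := (1 + ε / 2) / d with hc
  set x : Fin r → EuclideanSpace ℂ (Fin a × Fin d) := fun i => extendByZero e fun j => ψ (i, j)
  -- A zero component still receives a unit vector, chosen arbitrarily; its weight is zero.
  choose φ hφ hxφ using fun i => exists_unit_smul_eq (x i)
  have hsum : ∑ i, ‖x i‖ ^ 2 = 1 := by
    simp only [x, sq_norm_extendByZero]
    rw [← Fintype.sum_prod_type (f := fun p : Fin r × Fin m => ‖ψ p‖ ^ 2),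
      ← EuclideanSpace.norm_sq_eq, hψ, one_pow]
  have hle : ∀ k, opNorm (reducedState (restrictColumns (W k)⁻¹ e) ψ) ≤
      c + ∑ i, ‖x i‖ ^ 2 * excess c (φ i) (W k) := by
    intro k
    refine (opNorm_reducedState_le _ _).trans ?_
    have h1 : ∑ i, ‖x i‖ ^ 2 * c = c := by rw [← Finset.sum_mul, hsum, one_mul]
    refine le_of_le_of_eq ?_ (congrArg (· + _) h1)
    rw [← Finset.sum_add_distrib]
    refine Finset.sum_le_sum fun i _ => ?_
    rw [restrictColumns_mulVec_eq_act]
    exact sq_norm_slice_le_of_eq_smul c (hxφ i) (W k)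
  have hexc : ∀ k, 0 ≤ ∑ i, ‖x i‖ ^ 2 * excess c (φ i) (W k) := fun k =>
    Finset.sum_nonneg fun i _ => mul_nonneg (by positivity) (excess_nonneg _ _ _)
  have htotal : ∑ k, ∑ i, ‖x i‖ ^ 2 * excess c (φ i) (W k) ≤ n * (ε ^ 2 / (2 * d)) := by
    rw [Finset.sum_comm]
    calc ∑ i, ∑ k, ‖x i‖ ^ 2 * excess c (φ i) (W k)
        ≤ ∑ i, ‖x i‖ ^ 2 * (n * (ε ^ 2 / (2 * d))) := by
          refine Finset.sum_le_sum fun i _ => ?_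
          rw [← Finset.mul_sum]
          gcongr
          exact hW _ (hφ i)
      _ = _ := by rw [← Finset.sum_mul, hsum, one_mul]
  set F := Finset.univ.filter fun k => ¬ opNorm (reducedState (restrictColumns (W k)⁻¹ e) ψ)
        < (1 + ε) / d with hF
  have hcard : (F.card : ℝ) * (ε / (2 * d)) ≤ n * (ε ^ 2 / (2 * d)) := by
    calc (F.card : ℝ) * (ε / (2 * d)) = ∑ k ∈ F, ε / (2 * d) := by simp
      _ ≤ ∑ k ∈ F, ∑ i, ‖x i‖ ^ 2 * excess c (φ i) (W k) := by
          refine Finset.sum_le_sum fun k hk => ?_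
          have h1 := not_lt.mp (Finset.mem_filter.mp hk).2
          have h2 : (1 + ε) / d = c + ε / (2 * d) := by rw [hc]; field_simp; ring
          linarith [hle k]
      _ ≤ ∑ k, ∑ i, ‖x i‖ ^ 2 * excess c (φ i) (W k) :=
          Finset.sum_le_sum_of_subset_of_nonneg (Finset.subset_univ _) fun k _ _ => hexc k
      _ ≤ _ := htotal
  have h3 : (n : ℝ) * (ε ^ 2 / (2 * d)) = n * ε * (ε / (2 * d)) := by ring
  rw [h3] at hcard
  exact le_of_mul_le_mul_right hcard (by positivity)

end SuperdenseCoding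

/-- The case `m = d ^ 2` is that of isometries defined on a `d²`-dimensional space; the case
`m = dim A₂ * d` is that of unitaries of `A₂ ⊗ B` and of arbitrary pure states of `A₁A₂B`. -/
theorem lemma2 (ε : ℝ) (hε : 0 < ε) (hε1 : ε ≤ 1) (d : ℕ) (hd : 10 / ε ≤ (d : ℝ)) :
    d ^ 2 ≤ SuperdenseCoding.dimA₂ ε d * d ∧
    ∀ m : ℕ, m ≤ SuperdenseCoding.dimA₂ ε d * d →
      ∃ U : Fin (SuperdenseCoding.numIsometries ε d) →
          Matrix (Fin (SuperdenseCoding.dimA₂ ε d) × Fin d) (Fin m) ℂ,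
        (∀ k, SuperdenseCoding.IsIsometry (U k)) ∧
        ∀ (r : ℕ) (ψ : EuclideanSpace ℂ (Fin r × Fin m)), ‖ψ‖ = 1 →
          1 - ε ≤
            (Set.ncard {k | SuperdenseCoding.opNorm (SuperdenseCoding.reducedState (U k) ψ)
                < (1 + ε) / d} : ℝ) / (SuperdenseCoding.numIsometries ε d : ℝ) := by
  have hdε : 10 ≤ d * ε := (div_le_iff₀ hε).mp hd
  have hd10 : (10 : ℝ) ≤ d := by nlinarith
  have hd10' : 10 ≤ d := by exact_mod_cast hd10
  have hlog := SuperdenseCoding.log_natCast_ge_two hd10'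
  obtain ⟨ha1, ha2⟩ := SuperdenseCoding.dimA₂_bounds hε hd10'
  have hn := SuperdenseCoding.le_numIsometries hε d
  have hda : d ≤ SuperdenseCoding.dimA₂ ε d := by
    have h1 : 112 * (d * Real.log d) / 1 ≤ 112 * (d * Real.log d) / ε ^ 2 := by
      gcongr
      exact pow_le_one₀ hε.le hε1
    have h2 : (d : ℝ) ≤ SuperdenseCoding.dimA₂ ε d := by nlinarith
    exact_mod_cast h2
  refine ⟨by rw [sq]; gcongr, fun m hm => ?_⟩
  obtain ⟨W, hW⟩ := SuperdenseCoding.exists_unitaries_sum_excess_le hε hε1 hd ha1 ha2 hn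
  generalize SuperdenseCoding.dimA₂ ε d = a at *
  have hn0 : (0 : ℝ) < SuperdenseCoding.numIsometries ε d := lt_of_lt_of_le (by positivity) hn
  generalize SuperdenseCoding.numIsometries ε d = n at *
  let e : Fin m ↪ Fin a × Fin d :=
    (Fin.castLEEmb hm).trans finProdFinEquiv.symm.toEmbedding
  -- The excess was defined through `U⁻¹`, so the isometries come from the inverses of the selected
  -- unitaries.
  refine ⟨fun k => SuperdenseCoding.restrictColumns (W k)⁻¹ e,
    fun k => SuperdenseCoding.isIsometry_restrictColumns _ e, fun r ψ hψ => ?_⟩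
  have hfail := SuperdenseCoding.card_filter_le_of_sum_excess_le hε (by omega) (by omega) W e hW
    ψ hψ
  rw [le_div_iff₀ hn0, Set.ncard_eq_toFinset_card', Set.toFinset_ofPred]
  have hsplit := Finset.card_filter_add_card_filter_not (s := (Finset.univ : Finset (Fin n)))
    (fun k => SuperdenseCoding.opNorm (SuperdenseCoding.reducedState
      (SuperdenseCoding.restrictColumns (W k)⁻¹ e) ψ)
        < (1 + ε) / d)
  rw [Finset.card_univ, Fintype.card_fin] at hsplit
  have hsplit' := congrArg (Nat.cast : ℕ → ℝ) hsplit
  push_cast at hsplit'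
  linarith
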